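/- Let $\mathcal X$ be the Euclidean plane $\mathbb E^2$ or the hyperbolic plane $\mathbb H^2$, and let $\Gamma$ be a discrete group of isometries of $\mathcal X$ with a compact fundamental domain. Let $(\mathcal F,\Gamma)$ be a fundamental tile-1-transitive tiling: $\mathcal F$ is a locally finite set of closed topological disks that cover $\mathcal X$ and have pairwise disjoint interiors, $\Gamma$ maps tiles to tiles and acts transitively on $\mathcal F$, and every tile of $\mathcal F$ has trivial stabiliser in $\Gamma$. A vertex is a point contained in at least three tiles, and an edge is an arc in the boundary of a tile that joins two vertices and has no other vertex on it. The images of the edges under $p:\mathcal X\to O=\mathcal X/\Gamma$ are the edges of a graph $C$ in $O$. Let $S$ be a set of edges of $C$, and let $T$ be a tile of the tiling that results from $\mathcal F$ by erasing all edges $e$ with $p(e)\in S$; that is, for some $F\in\mathcal F$, $T$ is the union of all tiles of $\mathcal F$ that can be reached from $F$ by successively crossing erased edges. Let $H=\{\gamma\in\Gamma \mid \gamma T=T\}$ be the stabiliser of $T$. Then $H$ is infinite if and only if it contains a translation. Here a translation is a map $x\mapsto x+v$ with $v\neq 0$ if $\mathcal X=\mathbb E^2$, and an orientation-preserving hyperbolic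 isometry (in the upper half-plane model, the Möbius transformation of a matrix $A\in SL(2,\mathbb R)$ with $(\operatorname{tr}A)^2>4$) if $\mathcal X=\mathbb H^2$. -/

import Mathlib

open scoped UpperHalfPlane MatrixGroups

namespace RibbonTiling

section Groups

variable {X : Type*} [MetricSpace X]

/-- A group of isometries is discrete: the topology of pointwise convergence (which, on isometries,
is the compact-open topology) induces the discrete topology on it. -/
def IsDiscreteGroup (Γ : Subgroup (X ≃ᵢ X)) : Prop :=
  @DiscreteTopology Γ
    (TopologicalSpace.induced (fun (γ : Γ) (x : X) => (γ : X ≃ᵢ X) x) inferInstance)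

/-- `D` is a fundamental domain for `Γ`: its images cover, and distinct group elements give
images with disjoint interiors. -/
structure IsFundamentalDomain (Γ : Subgroup (X ≃ᵢ X)) (D : Set X) : Prop where
  cover : ∀ x : X, ∃ γ ∈ Γ, x ∈ γ '' D
  disjoint_interior : ∀ γ ∈ Γ, ∀ γ' ∈ Γ, γ ≠ γ' →
    Disjoint (interior (γ '' D)) (interior (γ' '' D))

/-- A crystallographic group: discrete, with a compact fundamental domain. For the Euclidean plane
these are the wallpaper groups, for the hyperbolic plane the (cocompact) NEC groups. -/
structure IsCrystallographic (Γ : Subgroup (X ≃ᵢ X)) : Prop where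
  discrete : IsDiscreteGroup Γ
  compact_domain : ∃ D : Set X, IsCompact D ∧ IsFundamentalDomain Γ D

/-- Two points are identified when an element of `Γ` maps one to the other. -/
def orbitSetoid (Γ : Subgroup (X ≃ᵢ X)) : Setoid X where
  r x y := ∃ γ ∈ Γ, y = γ x
  iseqv :=
    { refl := fun _ => ⟨1, Γ.one_mem, rfl⟩
      symm := by
        rintro x _ ⟨γ, hγ, rfl⟩
        exact ⟨γ⁻¹, Γ.inv_mem hγ, (γ.symm_apply_apply x).symm⟩
      trans := by
        rintro x _ _ ⟨γ, hγ, rfl⟩ ⟨δ, hδ, rfl⟩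
        exact ⟨δ * γ, Γ.mul_mem hδ hγ, rfl⟩ }

/-- The underlying space `O = X / Γ` of the orbifold. -/
abbrev OrbitSpace (Γ : Subgroup (X ≃ᵢ X)) : Type _ := Quotient (orbitSetoid Γ)

/-- The projection `p : X → O`. -/
def proj (Γ : Subgroup (X ≃ᵢ X)) : X → OrbitSpace Γ := Quotient.mk (orbitSetoid Γ)

/-- The stabiliser `Γ_T = {γ ∈ Γ | γ T = T}` of a tile. -/
def tileStabilizer (Γ : Subgroup (X ≃ᵢ X)) (T : Set X) : Subgroup (X ≃ᵢ X) where
  carrier := {γ | γ ∈ Γ ∧ γ '' T = T}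
  one_mem' := ⟨Γ.one_mem, by
    change (fun x => x) '' T = T
    exact Set.image_id' T⟩
  mul_mem' := by
    rintro a b ⟨ha, ha'⟩ ⟨hb, hb'⟩
    refine ⟨Γ.mul_mem ha hb, ?_⟩
    change (fun x => a (b x)) '' T = T
    rw [← Set.image_image a b T, hb', ha']
  inv_mem' := by
    rintro a ⟨ha, ha'⟩
    refine ⟨Γ.inv_mem ha, ?_⟩
    change a.symm '' T = T
    conv_lhs => rw [← ha']
    rw [Set.image_image]
    simp

end Groups

section Tilings

variable {X : Type*} [MetricSpace X]

/-- A subset homeomorphic to the closed unit disk of the Euclidean plane. -/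
def IsTopologicalDisk (T : Set X) : Prop :=
  Nonempty (T ≃ₜ Metric.closedBall (0 : EuclideanSpace ℝ (Fin 2)) 1)

/-- A locally finite tiling by topological disks. -/
structure IsDiskTiling (𝓕 : Set (Set X)) : Prop where
  disk : ∀ T ∈ 𝓕, IsTopologicalDisk T
  cover : ∀ x : X, ∃ T ∈ 𝓕, x ∈ T
  disjoint_interior : ∀ T ∈ 𝓕, ∀ T' ∈ 𝓕, T ≠ T' → Disjoint (interior T) (interior T')
  locally_finite : ∀ K : Set X, IsCompact K → {T ∈ 𝓕 | (T ∩ K).Nonempty}.Finite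

/-- `(𝓕, Γ)` is a fundamental tile-1-transitive equivariant tiling by disks: `Γ` maps tiles to
tiles, is transitive on them, and every tile has trivial stabiliser. -/
structure IsFundamentalTransitiveTiling (Γ : Subgroup (X ≃ᵢ X)) (𝓕 : Set (Set X)) : Prop
    extends IsDiskTiling 𝓕 where
  equivariant : ∀ γ ∈ Γ, (fun T : Set X => γ '' T) '' 𝓕 = 𝓕
  transitive : ∀ T ∈ 𝓕, ∀ T' ∈ 𝓕, ∃ γ ∈ Γ, γ '' T = T'
  fundamental : ∀ T ∈ 𝓕, tileStabilizer Γ T = ⊥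

/-- A vertex is a point that lies in at least three tiles. -/
def IsVertex (𝓕 : Set (Set X)) (x : X) : Prop :=
  3 ≤ {T ∈ 𝓕 | x ∈ T}.encard

/-- An edge is an arc in the boundary of a tile that joins two vertices and has no further
vertices on it. -/
def IsEdge (𝓕 : Set (Set X)) (e : Set X) : Prop :=
  ∃ T ∈ 𝓕, ∃ c : unitInterval → X, Continuous c ∧ Function.Injective c ∧ Set.range c = e ∧
    e ⊆ frontier T ∧ IsVertex 𝓕 (c 0) ∧ IsVertex 𝓕 (c 1) ∧
    ∀ t, t ≠ 0 → t ≠ 1 → ¬ IsVertex 𝓕 (c t)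

/-- The edges of the graph `C` in `O = X / Γ`: the images of the edges of the tiling. -/
def orbifoldEdges (Γ : Subgroup (X ≃ᵢ X)) (𝓕 : Set (Set X)) : Set (Set (OrbitSpace Γ)) :=
  {ε | ∃ e, IsEdge 𝓕 e ∧ proj Γ '' e = ε}

/-- Two tiles of `𝓕` meet along an edge that lies over an edge in `S`, i.e. along an edge that
is erased. -/
def GluedAlong (Γ : Subgroup (X ≃ᵢ X)) (𝓕 : Set (Set X)) (S : Set (Set (OrbitSpace Γ)))
    (T T' : Set X) : Prop :=
  T ∈ 𝓕 ∧ T' ∈ 𝓕 ∧ ∃ e, IsEdge 𝓕 e ∧ proj Γ '' e ∈ S ∧ e ⊆ T ∩ T'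

/-- The tile containing `F` after all preimages of the edges in `S` are erased: the union of the
tiles that can be reached from `F` by crossing erased edges. -/
def gluedTile (Γ : Subgroup (X ≃ᵢ X)) (𝓕 : Set (Set X)) (S : Set (Set (OrbitSpace Γ)))
    (F : Set X) : Set X :=
  ⋃₀ {F' | Relation.ReflTransGen (GluedAlong Γ 𝓕 S) F F'}

/-- The tiling obtained from `𝓕` by erasing all preimages of the edges in `S`. -/
def edgeDeletion (Γ : Subgroup (X ≃ᵢ X)) (𝓕 : Set (Set X)) (S : Set (Set (OrbitSpace Γ))) :
    Set (Set X) :=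
  gluedTile Γ 𝓕 S '' 𝓕

end Tilings

/-- The Euclidean plane. -/
abbrev EuclideanPlane : Type := EuclideanSpace ℝ (Fin 2)

/-- A (non-trivial) translation of the Euclidean plane. -/
def IsEuclideanTranslation (g : EuclideanPlane ≃ᵢ EuclideanPlane) : Prop :=
  ∃ v : EuclideanPlane, v ≠ 0 ∧ ∀ x, g x = x + v

/-- A (non-trivial) translation of the hyperbolic plane, in the upper half-plane model: the Möbius
transformation of a hyperbolic matrix (trace squared greater than 4) in `SL(2, ℝ)`. -/
def IsHyperbolicTranslation (g : ℍ ≃ᵢ ℍ) : Prop :=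
  ∃ A : SL(2, ℝ), (A : Matrix (Fin 2) (Fin 2) ℝ).IsHyperbolic ∧ ∀ z, g z = A • z

end RibbonTiling

/-! The stabiliser `H` is a subgroup of the discrete cocompact group `Γ`, and the equivalence holds
for every such subgroup. A translation has infinite order, so one direction asks only for distinct
powers. For the other, suppose that `H` contains no translation. It suffices that the
orientation-preserving elements of `H` are finite in number, since the reversing ones fill at most
one further coset (`finite_of_finite_index_two`). If some orientation-preserving `g ≠ 1` in `H`
exists, it fixes a point `p`. Every other orientation-preserving `h` in `H` must also fix `p`,
because otherwise the commutator of `g` and `h` is a translation. Point stabilisers in a discrete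
group are finite (`IsDiscreteGroup.finite_dist_le`).

In the Euclidean plane a commutator of orientation-preserving isometries has trivial linear part. In
the hyperbolic plane a trace computation shows that it is hyperbolic (`isHyperbolic_commutator`).
There cocompactness is essential: parabolic elements have no fixed point, generate infinite discrete
groups and are not hyperbolic. They are excluded because their displacement has infimum zero,
against `IsCrystallographic.exists_le_dist`. -/

namespace RibbonTiling

/-! ### Discrete groups of isometries: properness and displacement -/

section DiscreteGroups

variable {X : Type*} [MetricSpace X]

/-- In a discrete group of isometries the identity is isolated: an element that moves each of
finitely many suitable points by little is the identity. -/
theorem IsDiscreteGroup.exists_finset_eq_one {Γ : Subgroup (X ≃ᵢ X)} (h : IsDiscreteGroup Γ) :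
    ∃ (P : Finset X) (ε : ℝ), 0 < ε ∧ ∀ γ ∈ Γ, (∀ p ∈ P, dist (γ p) p < ε) → γ = 1 := by
  classical
  let _ : TopologicalSpace Γ :=
    TopologicalSpace.induced (fun (γ : Γ) (x : X) => (γ : X ≃ᵢ X) x) inferInstance
  have hd : DiscreteTopology Γ := h
  have h1 : ({1} : Set Γ) ∈ nhds (1 : Γ) := (isOpen_discrete _).mem_nhds rfl
  rw [nhds_induced, Filter.mem_comap] at h1
  obtain ⟨U, hU, hUs⟩ := h1
  rw [nhds_pi, Filter.mem_pi] at hU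
  obtain ⟨I, hI, t, ht, htU⟩ := hU
  choose e he heball using fun i => Metric.mem_nhds_iff.1 (ht i)
  obtain ⟨ε, hε, hle⟩ : ∃ ε : ℝ, 0 < ε ∧ ∀ i ∈ hI.toFinset, ε ≤ e i := by
    rcases hI.toFinset.eq_empty_or_nonempty with h0 | h0
    · exact ⟨1, one_pos, by simp [h0]⟩
    · exact ⟨hI.toFinset.inf' h0 e, (Finset.lt_inf'_iff h0).2 fun i _ => he i,
        fun i hi => Finset.inf'_le e hi⟩
  refine ⟨hI.toFinset, ε, hε, fun γ hγ hP => ?_⟩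
  have : (⟨γ, hγ⟩ : Γ) ∈ ({1} : Set Γ) := hUs <| htU fun i hi =>
    heball i <| Metric.mem_ball.2 <|
      (hP i (hI.mem_toFinset.2 hi)).trans_le (hle i (hI.mem_toFinset.2 hi))
  exact congrArg Subtype.val (Set.mem_singleton_iff.1 this)

/-- Discrete groups of isometries of a proper space act properly: only finitely many elements move
a given point by at most `r`. -/
theorem IsDiscreteGroup.finite_dist_le [ProperSpace X] {Γ : Subgroup (X ≃ᵢ X)}
    (h : IsDiscreteGroup Γ) (x : X) (r : ℝ) : {γ | γ ∈ Γ ∧ dist (γ x) x ≤ r}.Finite := by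
  obtain ⟨P, ε, hε, hP⟩ := h.exists_finset_eq_one
  -- Evaluation on `P` sends the set in question into a compact product of balls. Cover that by
  -- finitely many `ε / 2`-balls: two elements landing in the same ball differ by less than `ε` on
  -- `P`, hence coincide.
  let ev : (X ≃ᵢ X) → (P → X) := fun γ p => γ p
  have hK : IsCompact (Set.univ.pi fun p : P => Metric.closedBall x (dist (p : X) x + r)) :=
    isCompact_univ_pi fun _ => isCompact_closedBall _ _
  obtain ⟨t, ht, hcov⟩ := Metric.totallyBounded_iff.1 hK.totallyBounded (ε / 2) (half_pos hε)
  have : Nonempty (P → X) := ⟨fun _ => x⟩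
  have hnear : ∀ γ ∈ {γ | γ ∈ Γ ∧ dist (γ x) x ≤ r}, ∃ y ∈ t, dist (ev γ) y < ε / 2 := by
    rintro γ ⟨-, hr⟩
    have hmem : ev γ ∈ Set.univ.pi fun p : P => Metric.closedBall x (dist (p : X) x + r) :=
      fun p _ => Metric.mem_closedBall.2 <|
        (dist_triangle _ (γ x) _).trans (add_le_add (γ.dist_eq _ _).le hr)
    simpa using hcov hmem
  choose! c hct hc using hnear
  refine Set.Finite.of_finite_image (f := c) (ht.subset ?_) ?_
  · rintro _ ⟨γ, hγ, rfl⟩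
    exact hct γ hγ
  · intro γ hγ δ hδ hcc
    have h2 := hc δ hδ
    rw [← hcc] at h2
    have h3 : dist (ev γ) (ev δ) < ε :=
      (dist_triangle_right _ _ (c γ)).trans_lt (by linarith [hc γ hγ])
    have h4 := hP (δ⁻¹ * γ) (Γ.mul_mem (Γ.inv_mem hδ.1) hγ.1) fun p hp => by
      have h5 := (dist_pi_lt_iff hε).1 h3 ⟨p, hp⟩
      rw [← δ.dist_eq]
      simpa [ev] using h5
    exact (inv_mul_eq_one.1 h4).symm

/-- A fixed-point-free element of a discrete cocompact group of isometries has displacement bounded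
away from zero. -/
theorem IsCrystallographic.exists_le_dist [ProperSpace X] {Γ : Subgroup (X ≃ᵢ X)}
    (h : IsCrystallographic Γ) {γ : X ≃ᵢ X} (hγ : γ ∈ Γ) (hfix : ∀ x, γ x ≠ x) :
    ∃ c : ℝ, 0 < c ∧ ∀ x, c ≤ dist (γ x) x := by
  obtain ⟨D, hD, hfd⟩ := h.compact_domain
  by_contra! hc
  choose x hx using fun n : ℕ => hc (1 / ((n : ℝ) + 1)) Nat.one_div_pos_of_nat
  choose g hg y hy hgy using fun n => hfd.cover (x n)
  obtain ⟨a, -, φ, hφ, hlim⟩ := hD.tendsto_subseq hy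
  -- Conjugation moves the points of small displacement into the compact set `D`, at the price of
  -- replacing `γ` by varying conjugates.
  let δ : ℕ → X ≃ᵢ X := fun n => (g n)⁻¹ * γ * g n
  have hδΓ : ∀ n, δ n ∈ Γ := fun n => Γ.mul_mem (Γ.mul_mem (Γ.inv_mem (hg n)) hγ) (hg n)
  have hδd : ∀ n, dist (δ n (y n)) (y n) < 1 / ((n : ℝ) + 1) := fun n => by
    have := hx n
    rw [← hgy n] at this
    rw [← (g n).dist_eq]
    simpa [δ] using this
  have hδa : Filter.Tendsto (fun n => dist (δ (φ n) a) a) Filter.atTop (nhds 0) := by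
    have h1 : Filter.Tendsto (fun n => 2 * dist (y (φ n)) a + 1 / (((φ n : ℕ) : ℝ) + 1))
        Filter.atTop (nhds (2 * 0 + 0)) :=
      ((tendsto_iff_dist_tendsto_zero.1 hlim).const_mul 2).add
        (tendsto_one_div_add_atTop_nhds_zero_nat.comp hφ.tendsto_atTop)
    rw [mul_zero, add_zero] at h1
    refine squeeze_zero (fun _ => dist_nonneg) (fun n => ?_) h1
    have h2 := dist_triangle4 (δ (φ n) a) (δ (φ n) (y (φ n))) (y (φ n)) a
    rw [(δ (φ n)).dist_eq, dist_comm a] at h2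
    linarith [hδd (φ n)]
  -- By properness the displacements at `a` that are at most 1 form a finite set, so a sequence of
  -- them tending to 0 reaches 0. Some conjugate of `γ` then fixes `a`.
  have hfin : ((fun δ : X ≃ᵢ X => dist (δ a) a) '' {δ | δ ∈ Γ ∧ dist (δ a) a ≤ 1}).Finite :=
    (h.discrete.finite_dist_le a 1).image _
  have hopen : (((fun δ : X ≃ᵢ X => dist (δ a) a) '' {δ | δ ∈ Γ ∧ dist (δ a) a ≤ 1}) \ {0})ᶜ ∈
      nhds (0 : ℝ) :=
    (hfin.subset Set.sdiff_subset).isClosed.isOpen_compl.mem_nhds (by simp)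
  obtain ⟨n, hn1, hn2⟩ := ((hδa.eventually hopen).and
    (hδa.eventually (Iio_mem_nhds one_pos))).exists
  have h0 : dist (δ (φ n) a) a = 0 := by
    by_contra hne
    exact hn1 ⟨⟨_, ⟨hδΓ _, le_of_lt hn2⟩, rfl⟩, hne⟩
  refine hfix (g (φ n) a) ?_
  have h3 : (g (φ n))⁻¹ (γ (g (φ n) a)) = a := dist_eq_zero.1 h0
  conv_rhs => rw [← h3]
  simp

/-- If the orientation-preserving elements of a group are finite in number, the group is finite. -/
theorem finite_of_finite_index_two {G : Type*} [Group G] (H : Subgroup G) (P : G → Prop)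
    (hP : ∀ g ∈ H, ∀ h ∈ H, ¬ P g → ¬ P h → P (g * h⁻¹)) (hfin : {g | g ∈ H ∧ P g}.Finite) :
    Finite H := by
  by_cases hall : ∀ g ∈ H, P g
  · exact (hfin.subset fun g hg => ⟨hg, hall g hg⟩ : (H : Set G).Finite).to_subtype
  · push Not at hall
    obtain ⟨g₀, hg₀, hn⟩ := hall
    refine ((hfin.union (hfin.image fun g => g * g₀)).subset fun g hg => ?_ :
      (H : Set G).Finite).to_subtype
    by_cases hg' : P g
    · exact Or.inl ⟨hg, hg'⟩
    · exact Or.inr ⟨g * g₀⁻¹, ⟨H.mul_mem hg (H.inv_mem hg₀), hP g hg g₀ hg₀ hg' hn⟩, by simp⟩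

end DiscreteGroups

/-! ### The Euclidean plane: linear parts and commutators -/

section Euclidean

/-- The linear part of an isometry of the Euclidean plane. -/
noncomputable def linearPart (g : EuclideanPlane ≃ᵢ EuclideanPlane) :
    EuclideanPlane ≃ₗᵢ[ℝ] EuclideanPlane :=
  g.toRealAffineIsometryEquiv.linearIsometryEquiv

theorem apply_sub_apply (g : EuclideanPlane ≃ᵢ EuclideanPlane) (x y : EuclideanPlane) :
    g x - g y = linearPart g (x - y) := by
  have := g.toRealAffineIsometryEquiv.map_vsub x y
  simpa [linearPart] using this.symm

theorem linearPart_mul (g h : EuclideanPlane ≃ᵢ EuclideanPlane) :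
    linearPart (g * h) = linearPart g * linearPart h := by
  ext1 x
  have := apply_sub_apply (g * h) x 0
  rw [sub_zero] at this
  rw [← this, IsometryEquiv.mul_apply, IsometryEquiv.mul_apply, apply_sub_apply, apply_sub_apply,
    sub_zero]
  rfl

/-- `linearPart` as a homomorphism. -/
noncomputable def linearPartHom :
    (EuclideanPlane ≃ᵢ EuclideanPlane) →* (EuclideanPlane ≃ₗᵢ[ℝ] EuclideanPlane) :=
  MonoidHom.mk' linearPart linearPart_mul

theorem linearPartHom_apply (g : EuclideanPlane ≃ᵢ EuclideanPlane) :
    linearPartHom g = linearPart g := rfl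

theorem eq_one_or_isEuclideanTranslation {g : EuclideanPlane ≃ᵢ EuclideanPlane}
    (h : linearPart g = 1) : g = 1 ∨ IsEuclideanTranslation g := by
  have hg : ∀ x, g x = x + g 0 := fun x => by
    have := apply_sub_apply g x 0
    rw [h, sub_zero] at this
    exact sub_eq_iff_eq_add.1 this
  by_cases h0 : g 0 = 0
  · left
    ext1 x
    rw [hg, h0, add_zero]
    rfl
  · exact Or.inr ⟨g 0, h0, hg⟩

/-- Isometries that preserve the orientation of the Euclidean plane. -/
def IsOrientationPreserving (g : EuclideanPlane ≃ᵢ EuclideanPlane) : Prop :=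
  0 < LinearMap.det ((linearPart g).toLinearEquiv : EuclideanPlane →ₗ[ℝ] EuclideanPlane)

theorem det_linearPart_mul (g h : EuclideanPlane ≃ᵢ EuclideanPlane) :
    LinearMap.det ((linearPart (g * h)).toLinearEquiv : EuclideanPlane →ₗ[ℝ] EuclideanPlane) =
      LinearMap.det ((linearPart g).toLinearEquiv : EuclideanPlane →ₗ[ℝ] EuclideanPlane) *
      LinearMap.det ((linearPart h).toLinearEquiv : EuclideanPlane →ₗ[ℝ] EuclideanPlane) := by
  rw [linearPart_mul, ← LinearMap.det_comp]
  rfl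

theorem isOrientationPreserving_mul_inv {g h : EuclideanPlane ≃ᵢ EuclideanPlane}
    (hg : ¬ IsOrientationPreserving g) (hh : ¬ IsOrientationPreserving h) :
    IsOrientationPreserving (g * h⁻¹) := by
  unfold IsOrientationPreserving at *
  have h1 := det_linearPart_mul (g * h⁻¹) h
  rw [inv_mul_cancel_right] at h1
  have h2 : LinearMap.det ((linearPart g).toLinearEquiv : EuclideanPlane →ₗ[ℝ] EuclideanPlane) ≠ 0 :=
    ((linearPart g).toLinearEquiv.isUnit_det').ne_zero
  have h3 := lt_of_le_of_ne (not_lt.1 hg) h2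
  rw [h1] at h3
  exact pos_of_mul_neg_left h3 (not_lt.1 hh)

instance : Fact (Module.finrank ℝ EuclideanPlane = 2) := ⟨by simp⟩

/-- An orientation of the Euclidean plane. -/
noncomputable def planeOrientation : Orientation ℝ EuclideanPlane (Fin 2) :=
  (EuclideanSpace.basisFun (Fin 2) ℝ).toBasis.orientation

theorem IsOrientationPreserving.exists_eq_rotation {g : EuclideanPlane ≃ᵢ EuclideanPlane}
    (hg : IsOrientationPreserving g) : ∃ θ, linearPart g = planeOrientation.rotation θ :=
  planeOrientation.exists_linearIsometryEquiv_eq_of_det_pos hg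

/-- Rotations of the plane commute. Hence in a group without translations any two
orientation-preserving elements commute. -/
theorem IsOrientationPreserving.linearPart_commutator {g h : EuclideanPlane ≃ᵢ EuclideanPlane}
    (hg : IsOrientationPreserving g) (hh : IsOrientationPreserving h) :
    linearPart (g * h * g⁻¹ * h⁻¹) = 1 := by
  obtain ⟨θ, hθ⟩ := hg.exists_eq_rotation
  obtain ⟨η, hη⟩ := hh.exists_eq_rotation
  have hcomm : linearPartHom g * linearPartHom h = linearPartHom h * linearPartHom g := by
    rw [linearPartHom_apply, linearPartHom_apply, hθ, hη]
    ext1 x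
    change planeOrientation.rotation θ (planeOrientation.rotation η x) =
      planeOrientation.rotation η (planeOrientation.rotation θ x)
    rw [Orientation.rotation_rotation, Orientation.rotation_rotation, add_comm]
  rw [← linearPartHom_apply, map_mul, map_mul, map_mul, hcomm, map_inv, map_inv]
  group

/-- An orientation-preserving isometry with non-trivial linear part has exactly one fixed point. -/
theorem IsOrientationPreserving.existsUnique_fixed {g : EuclideanPlane ≃ᵢ EuclideanPlane}
    (hg : IsOrientationPreserving g) (h1 : linearPart g ≠ 1) : ∃! x, g x = x := by
  obtain ⟨θ, hθ⟩ := hg.exists_eq_rotation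
  have hθ0 : θ ≠ 0 := by
    rintro rfl
    apply h1
    rw [hθ, Orientation.rotation_zero]
    rfl
  have hker : ∀ x, linearPart g x = x → x = 0 := fun x hx => by
    rw [hθ, Orientation.rotation_eq_self_iff] at hx
    exact hx.resolve_right hθ0
  -- A fixed point solves `L p = g 0`. A non-trivial rotation fixes only 0, so `L` is injective and,
  -- by finite dimension, surjective.
  let L : EuclideanPlane →ₗ[ℝ] EuclideanPlane :=
    LinearMap.id - ((linearPart g).toLinearEquiv : EuclideanPlane →ₗ[ℝ] EuclideanPlane)
  have hL : ∀ x, L x = x - linearPart g x := fun x => rfl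
  have hinj : Function.Injective L := (injective_iff_map_eq_zero L).2 fun x hx =>
    hker x (sub_eq_zero.1 ((hL x).symm.trans hx)).symm
  obtain ⟨p, hp⟩ := (LinearMap.injective_iff_surjective.1 hinj) (g 0)
  have hgp : g p = p := by
    have := apply_sub_apply g p 0
    rw [sub_zero] at this
    rw [hL] at hp
    rw [sub_eq_iff_eq_add.1 this, ← hp, add_sub_cancel]
  refine ⟨p, hgp, fun q hq => ?_⟩
  have h2 := apply_sub_apply g q p
  rw [show g q = q from hq, hgp] at h2
  exact sub_eq_zero.1 (hker _ h2.symm)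

/-- An infinite discrete group of isometries of the Euclidean plane contains a translation. -/
theorem exists_isEuclideanTranslation {Γ H : Subgroup (EuclideanPlane ≃ᵢ EuclideanPlane)}
    (hΓ : IsDiscreteGroup Γ) (hH : H ≤ Γ) (hinf : Infinite H) :
    ∃ g ∈ H, IsEuclideanTranslation g := by
  by_contra! hno
  refine not_finite_iff_infinite.2 hinf (finite_of_finite_index_two H IsOrientationPreserving
    (fun g _ h _ => isOrientationPreserving_mul_inv) ?_)
  have hlin : ∀ g ∈ H, linearPart g = 1 → g = 1 := fun g hg h1 =>
    (eq_one_or_isEuclideanTranslation h1).resolve_right (hno g hg)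
  by_cases htriv : ∀ g ∈ H, IsOrientationPreserving g → g = 1
  · exact (Set.finite_singleton 1).subset fun g hg => htriv g hg.1 hg.2
  push Not at htriv
  obtain ⟨g, hg, hgo, hg1⟩ := htriv
  obtain ⟨p, hp, huniq⟩ := hgo.existsUnique_fixed fun h => hg1 (hlin g hg h)
  -- Radius 0 gives the stabiliser of `p`. An `h` commuting with `g` permutes the fixed points of
  -- `g`, and `p` is the only one.
  refine (hΓ.finite_dist_le p 0).subset fun h hh => ⟨hH hh.1, ?_⟩
  have hcomm : g * h = h * g := by
    have := hlin _ (H.mul_mem (H.mul_mem (H.mul_mem hg hh.1) (H.inv_mem hg)) (H.inv_mem hh.1))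
      (hgo.linearPart_commutator hh.2)
    rw [mul_inv_eq_one, mul_inv_eq_iff_eq_mul] at this
    exact this
  have : h p = p := huniq _ <| by
    change g (h p) = h p
    have h2 := congrArg (fun f : EuclideanPlane ≃ᵢ EuclideanPlane => f p) hcomm
    simp only [IsometryEquiv.mul_apply] at h2
    rw [h2, hp]
  rw [this, dist_self]

theorem IsEuclideanTranslation.infinite {H : Subgroup (EuclideanPlane ≃ᵢ EuclideanPlane)}
    {g : EuclideanPlane ≃ᵢ EuclideanPlane} (hg : g ∈ H) (ht : IsEuclideanTranslation g) :
    Infinite H := by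
  obtain ⟨v, hv, hgv⟩ := ht
  have hpow : ∀ n : ℕ, (g ^ n) 0 = n • v := fun n => by
    induction n with
    | zero => simp
    | succ n ih => rw [pow_succ', IsometryEquiv.mul_apply, ih, hgv, succ_nsmul]
  refine Infinite.of_injective (fun n : ℕ => (⟨g ^ n, H.pow_mem hg n⟩ : H)) fun m n hmn => ?_
  have h1 : (g ^ m) 0 = (g ^ n) 0 := 
    congrArg (fun f : H => (f : EuclideanPlane ≃ᵢ EuclideanPlane) 0) hmn
  rw [hpow, hpow, ← Nat.cast_smul_eq_nsmul ℝ, ← Nat.cast_smul_eq_nsmul ℝ n] at h1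
  exact_mod_cast smul_left_injective ℝ hv h1

end Euclidean

/-! ### The hyperbolic plane: fixed points, displacement and commutators in `SL(2, ℝ)` -/

section Hyperbolic

open UpperHalfPlane

/-- The quadratic has discriminant `tr² - 4`, and its modulus also bounds the displacement in
`dist_sl_smul_le`. -/
theorem sl_smul_eq_self_iff (A : SL(2, ℝ)) (z : ℍ) :
    A • z = z ↔
      ((A 1 0 : ℝ) * (z * z) + ((A 1 1 : ℝ) - (A 0 0 : ℝ)) * z + -(A 0 1 : ℝ) : ℂ) = 0 := by
  rw [MulAction.compHom_smul_def, gl_smul_eq_self_iff_quadratic (by simp)]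
  simp

theorem sl_smul_I_eq_I_iff (A : SL(2, ℝ)) : A • I = I ↔ A 0 0 = A 1 1 ∧ A 0 1 = -A 1 0 := by
  rw [MulAction.compHom_smul_def, gl_smul_I_eq_I_iff_of_pos (by simp)]
  simp

theorem sl_discr (A : SL(2, ℝ)) :
    (A : Matrix (Fin 2) (Fin 2) ℝ).discr = (A 0 0 + A 1 1) ^ 2 - 4 := by
  simp [Matrix.discr_fin_two, Matrix.trace_fin_two]

theorem sl_det_eq (A : SL(2, ℝ)) : A 0 0 * A 1 1 - A 0 1 * A 1 0 = 1 := by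
  have := A.det_coe
  rwa [Matrix.det_fin_two] at this

theorem exists_fixed_of_discr_neg {A : SL(2, ℝ)}
    (h : (A : Matrix (Fin 2) (Fin 2) ℝ).discr < 0) : ∃ z : ℍ, A • z = z := by
  have he : (Matrix.SpecialLinearGroup.mapGL ℝ A).IsElliptic := by
    simpa [Matrix.IsElliptic] using h
  exact ⟨fixedPt _ he, by
    rw [MulAction.compHom_smul_def, gl_smul_eq_self_iff_eq_fixedPt (by simp) he]⟩

/-- An upper bound for the displacement of a Möbius transformation. -/
theorem dist_sl_smul_le (A : SL(2, ℝ)) (z : ℍ) :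
    dist (A • z) z ≤
      ‖((A 1 0 : ℝ) * (z * z) + ((A 1 1 : ℝ) - (A 0 0 : ℝ)) * z + -(A 0 1 : ℝ) : ℂ)‖ / z.im := by
  have hden : ((A 1 0 : ℝ) * z + (A 1 1 : ℝ) : ℂ) ≠ 0 := by
    simpa [denom] using denom_ne_zero (Matrix.SpecialLinearGroup.mapGL ℝ A) z
  have hpos := norm_pos_iff.2 hden
  have him : (A • z).im = z.im / ‖((A 1 0 : ℝ) * z + (A 1 1 : ℝ) : ℂ)‖ ^ 2 := by
    rw [MulAction.compHom_smul_def, im_smul_eq_div_normSq, Complex.normSq_eq_norm_sq]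
    simp [denom]
  have hsq : √((A • z).im * z.im) = z.im / ‖((A 1 0 : ℝ) * z + (A 1 1 : ℝ) : ℂ)‖ := by
    rw [him, Real.sqrt_eq_iff_mul_self_eq (by positivity) (by positivity)]
    field_simp
  refine (dist_le_dist_coe_div_sqrt _ _).trans_eq ?_
  have hsub : ((A • z : ℍ) : ℂ) - z =
      -((A 1 0 : ℝ) * (z * z) + ((A 1 1 : ℝ) - (A 0 0 : ℝ)) * z + -(A 0 1 : ℝ)) /
        ((A 1 0 : ℝ) * z + (A 1 1 : ℝ)) := by
    rw [coe_specialLinearGroup_apply]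
    simp only [Algebra.algebraMap_self, RingHom.id_apply]
    rw [div_sub' hden]
    ring
  rw [hsq, dist_eq_norm, hsub, norm_div, norm_neg, div_div_div_cancel_right₀ hpos.ne']

/-- Möbius transformations with trace `±2` have arbitrarily small displacement. -/
theorem exists_dist_smul_lt_of_discr_eq_zero {A : SL(2, ℝ)}
    (h : (A : Matrix (Fin 2) (Fin 2) ℝ).discr = 0) {ε : ℝ} (hε : 0 < ε) :
    ∃ z : ℍ, dist (A • z) z < ε := by
  rw [sl_discr] at h
  have hdet := sl_det_eq A
  by_cases hc : A 1 0 = 0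
  -- Here `A` acts as a horizontal shift, whose displacement tends to 0 high up in the half-plane.
  · have had : A 1 1 = A 0 0 := by
      have : (A 1 1 - A 0 0) ^ 2 = 0 := by
        rw [hc] at hdet
        linear_combination h - 4 * hdet
      exact sub_eq_zero.1 (pow_eq_zero_iff two_ne_zero |>.1 this)
    obtain ⟨y, hy, hby⟩ : ∃ y : ℝ, 0 < y ∧ |A 0 1| < ε * y :=
      ⟨(|A 0 1| + 1) / ε, by positivity, by rw [mul_div_cancel₀ _ hε.ne']; exact lt_add_one _⟩
    refine ⟨⟨⟨0, y⟩, hy⟩, (dist_sl_smul_le _ _).trans_lt ?_⟩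
    change _ / y < ε
    rw [div_lt_iff₀ hy, hc, had]
    simpa using hby
  -- The quadratic has the double real root `(a - d) / (2c)`. At height `y` above it its value is
  -- `-c y²`, so the displacement bound is `|c| y`.
  · obtain ⟨y, hy, hcy⟩ : ∃ y : ℝ, 0 < y ∧ |A 1 0| * y < ε := by
      refine ⟨ε / (|A 1 0| + 1), by positivity, ?_⟩
      rw [← mul_div_assoc, div_lt_iff₀ (by positivity)]
      linarith [mul_comm ε |A 1 0|]
    refine ⟨⟨⟨(A 0 0 - A 1 1) / (2 * A 1 0), y⟩, hy⟩, (dist_sl_smul_le _ _).trans_lt ?_⟩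
    have hval : ((A 1 0 : ℝ) * ((⟨(A 0 0 - A 1 1) / (2 * A 1 0), y⟩ : ℂ) *
        (⟨(A 0 0 - A 1 1) / (2 * A 1 0), y⟩ : ℂ)) + ((A 1 1 : ℝ) - (A 0 0 : ℝ)) *
        (⟨(A 0 0 - A 1 1) / (2 * A 1 0), y⟩ : ℂ) + -(A 0 1 : ℝ) : ℂ) =
        ((-(A 1 0 * y * y) : ℝ) : ℂ) := by
      apply Complex.ext
      · rw [Complex.ofReal_re]
        simp only [Complex.add_re, Complex.mul_re, Complex.sub_re, Complex.neg_re,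
          Complex.ofReal_re, Complex.ofReal_im, Complex.sub_im, Complex.mul_im]
        field_simp
        linear_combination -h + 4 * hdet
      · rw [Complex.ofReal_im]
        simp only [Complex.add_im, Complex.mul_re, Complex.sub_re, Complex.neg_im,
          Complex.ofReal_re, Complex.ofReal_im, Complex.sub_im, Complex.mul_im]
        field_simp
        ring
    change ‖((A 1 0 : ℝ) * ((⟨(A 0 0 - A 1 1) / (2 * A 1 0), y⟩ : ℂ) *
        (⟨(A 0 0 - A 1 1) / (2 * A 1 0), y⟩ : ℂ)) + ((A 1 1 : ℝ) - (A 0 0 : ℝ)) *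
        (⟨(A 0 0 - A 1 1) / (2 * A 1 0), y⟩ : ℂ) + -(A 0 1 : ℝ) : ℂ)‖ / y < ε
    rw [hval, Complex.norm_real, Real.norm_eq_abs, abs_neg, abs_mul, abs_mul, abs_of_pos hy,
      mul_div_cancel_right₀ _ hy.ne']
    exact hcy

/-- If `A` is a non-trivial rotation about `I` and `B` moves `I`, then `[A, B]` is hyperbolic. -/
theorem isHyperbolic_commutator_of_smul_I {A B : SL(2, ℝ)} (hA : A • I = I) (hA0 : A 1 0 ≠ 0)
    (hB : B • I ≠ I) :
    ((A * B * A⁻¹ * B⁻¹ : SL(2, ℝ)) : Matrix (Fin 2) (Fin 2) ℝ).IsHyperbolic := by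
  rw [sl_smul_I_eq_I_iff] at hA
  rw [Ne, sl_smul_I_eq_I_iff] at hB
  have hdA := sl_det_eq A
  have hdB := sl_det_eq B
  rw [hA.1, hA.2] at hdA
  have hpos : 0 < (B 0 0 - B 1 1) ^ 2 + (B 0 1 + B 1 0) ^ 2 := by
    by_contra! hle
    refine hB ⟨?_, ?_⟩ <;> nlinarith [sq_nonneg (B 0 0 - B 1 1), sq_nonneg (B 0 1 + B 1 0)]
  -- The sum of squares vanishes exactly when `B` fixes `I`, so the trace of the commutator exceeds
  -- 2.
  have htr : (A * B * A⁻¹ * B⁻¹ : SL(2, ℝ)) 0 0 + (A * B * A⁻¹ * B⁻¹ : SL(2, ℝ)) 1 1 =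
      2 + A 1 0 ^ 2 * ((B 0 0 - B 1 1) ^ 2 + (B 0 1 + B 1 0) ^ 2) := by
    simp only [Matrix.SpecialLinearGroup.coe_mul, Matrix.SpecialLinearGroup.coe_inv,
      Matrix.adjugate_fin_two, Matrix.mul_apply, Fin.sum_univ_two, Matrix.of_apply,
      Matrix.cons_val', Matrix.cons_val_zero, Matrix.cons_val_one, Matrix.cons_val_fin_one,
      hA.1, hA.2]
    linear_combination (2 * (B 0 0 * B 1 1 - B 0 1 * B 1 0)) * hdA + 2 * hdB
  have hA2 : 0 < A 1 0 ^ 2 := by positivity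
  rw [Matrix.IsHyperbolic, sl_discr, htr]
  nlinarith [mul_pos hA2 hpos]

/-- If `A` acts as a non-trivial rotation about `p` and `B` moves `p`, then `[A, B]` is
hyperbolic. -/
theorem isHyperbolic_commutator {A B : SL(2, ℝ)} {p w : ℍ} (hA : A • p = p) (hAw : A • w ≠ w)
    (hB : B • p ≠ p) :
    ((A * B * A⁻¹ * B⁻¹ : SL(2, ℝ)) : Matrix (Fin 2) (Fin 2) ℝ).IsHyperbolic := by
  obtain ⟨M, rfl⟩ := MulAction.exists_smul_eq SL(2, ℝ) I p
  have h1 : (M⁻¹ * A * M) • I = I := by rw [mul_smul, mul_smul, hA, inv_smul_smul]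
  have h2 : (M⁻¹ * B * M) • I ≠ I := by
    rw [mul_smul, mul_smul, Ne, inv_smul_eq_iff]
    exact hB
  -- A matrix fixing `I` with lower left entry 0 is scalar and would fix `M⁻¹ • w`.
  have h3 : (M⁻¹ * A * M) 1 0 ≠ 0 := fun h0 => hAw <| by
    have h4 := (sl_smul_I_eq_I_iff _).1 h1
    have h5 : (M⁻¹ * A * M) • (M⁻¹ • w) = M⁻¹ • w := by
      rw [sl_smul_eq_self_iff, h0, h4.1, h4.2, h0]
      simp
    rwa [mul_smul, mul_smul, smul_inv_smul, smul_left_cancel_iff] at h5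
  have h6 := isHyperbolic_commutator_of_smul_I h1 h3 h2
  have h7 : (M⁻¹ * A * M) * (M⁻¹ * B * M) * (M⁻¹ * A * M)⁻¹ * (M⁻¹ * B * M)⁻¹ =
      M⁻¹ * (A * B * A⁻¹ * B⁻¹) * M := by group
  rw [h7] at h6
  rw [Matrix.IsHyperbolic, sl_discr] at h6 ⊢
  have htr : (M⁻¹ * (A * B * A⁻¹ * B⁻¹) * M : SL(2, ℝ)) 0 0 +
      (M⁻¹ * (A * B * A⁻¹ * B⁻¹) * M : SL(2, ℝ)) 1 1 =
      (A * B * A⁻¹ * B⁻¹ : SL(2, ℝ)) 0 0 + (A * B * A⁻¹ * B⁻¹ : SL(2, ℝ)) 1 1 := by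
    rw [← Matrix.trace_fin_two, ← Matrix.trace_fin_two, Matrix.SpecialLinearGroup.coe_mul,
      Matrix.trace_mul_comm, ← Matrix.SpecialLinearGroup.coe_mul, mul_inv_cancel_left]
  rwa [htr] at h6

/-! ### Classification of the isometries of the hyperbolic plane -/

/-- The point `2I`. -/
noncomputable def twoI : ℍ := ⟨⟨0, 2⟩, two_pos⟩

/-- The point `1 + I`. -/
noncomputable def onePlusI : ℍ := ⟨⟨1, 1⟩, one_pos⟩

@[simp] theorem twoI_re : twoI.re = 0 := rfl

@[simp] theorem twoI_im : twoI.im = 2 := rfl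

@[simp] theorem onePlusI_re : onePlusI.re = 1 := rfl

@[simp] theorem onePlusI_im : onePlusI.im = 1 := rfl

theorem dist_eq_dist_iff (z w p q : ℍ) : dist z p = dist w q ↔
    ((z.re - p.re) ^ 2 + z.im ^ 2 + p.im ^ 2) / (2 * z.im * p.im) =
      ((w.re - q.re) ^ 2 + w.im ^ 2 + q.im ^ 2) / (2 * w.im * q.im) := by
  rw [← cosh_dist', ← cosh_dist',
    Real.cosh_strictMonoOn.injOn.eq_iff (Set.mem_Ici.2 dist_nonneg) (Set.mem_Ici.2 dist_nonneg)]

/-- After cross-multiplication the terms in `re ^ 2` and `im ^ 2` cancel between the two equations,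
which leaves the equality of the imaginary parts. Both centres lie on the imaginary axis, so the
sign of the real part stays undetermined. -/
theorem im_eq_and_re_sq_eq_of_dist_eq {z w : ℍ} (h1 : dist z I = dist w I)
    (h2 : dist z twoI = dist w twoI) : z.im = w.im ∧ z.re ^ 2 = w.re ^ 2 := by
  have hz := z.im_pos
  have hw := w.im_pos
  rw [dist_eq_dist_iff] at h1 h2
  simp only [I_re, I_im, twoI_re, twoI_im] at h1 h2
  rw [div_eq_div_iff (by positivity) (by positivity)] at h1 h2
  have him : z.im = w.im := by linarith
  refine ⟨him, ?_⟩
  rw [him] at h1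
  have := mul_right_cancel₀ (by positivity) h1
  linarith

/-- A point of `ℍ` is determined by its distances to `I`, `2I` and `1 + I`. -/
theorem eq_of_dist_eq {z w : ℍ} (h1 : dist z I = dist w I) (h2 : dist z twoI = dist w twoI)
    (h3 : dist z onePlusI = dist w onePlusI) : z = w := by
  obtain ⟨him, hre⟩ := im_eq_and_re_sq_eq_of_dist_eq h1 h2
  have hw := w.im_pos
  rw [dist_eq_dist_iff, him] at h3
  simp only [onePlusI_re, onePlusI_im] at h3
  rw [div_left_inj' (by positivity)] at h3
  refine UpperHalfPlane.ext (Complex.ext ?_ him)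
  change z.re = w.re
  linarith

/-- The rotations about `I` act transitively on circles around `I`. -/
theorem exists_smul_eq_twoI {z : ℍ} (h : dist z I = dist twoI I) :
    ∃ K : SL(2, ℝ), K • I = I ∧ K • z = twoI := by
  -- The expression is the numerator of the real part of `R • z` for the rotation `R` below. It
  -- changes sign between 0 and `π / 2`.
  obtain ⟨θ, hθ⟩ : ∃ θ : ℝ, Real.cos θ * Real.sin θ * (1 - z.re ^ 2 - z.im ^ 2) +
      (Real.cos θ ^ 2 - Real.sin θ ^ 2) * z.re = 0 := by
    let f : ℝ → ℝ := fun θ => Real.cos θ * Real.sin θ * (1 - z.re ^ 2 - z.im ^ 2) +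
      (Real.cos θ ^ 2 - Real.sin θ ^ 2) * z.re
    have hf : Continuous f := by fun_prop
    have h0 : f 0 = z.re := by simp [f]
    have h1 : f (Real.pi / 2) = -z.re := by simp [f]
    have hmem : (0 : ℝ) ∈ Set.uIcc (f 0) (f (Real.pi / 2)) := by
      rw [h0, h1, Set.mem_uIcc]
      rcases le_total z.re 0 with hz | hz
      · exact Or.inl ⟨hz, by linarith⟩
      · exact Or.inr ⟨by linarith, hz⟩
    obtain ⟨θ, -, hθ⟩ := intermediate_value_uIcc hf.continuousOn hmem
    exact ⟨θ, hθ⟩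
  let R : SL(2, ℝ) := ⟨!![Real.cos θ, Real.sin θ; -Real.sin θ, Real.cos θ], by
    rw [Matrix.det_fin_two_of]; linear_combination Real.cos_sq_add_sin_sq θ⟩
  have hRI : R • I = I := (sl_smul_I_eq_I_iff R).2 ⟨rfl, (neg_neg _).symm⟩
  have hre : (R • z).re = 0 := by
    rw [← coe_re, coe_specialLinearGroup_apply, Complex.div_re, ← add_div]
    refine div_eq_zero_iff.2 (Or.inl ?_)
    simp [R, -Complex.ofReal_cos, -Complex.ofReal_sin]
    linear_combination hθ
  have hd : dist (R • z) I = dist twoI I := by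
    rw [← h]
    conv_lhs => rw [← hRI]
    exact dist_smul R z I
  have hpos := (R • z).im_pos
  rw [dist_eq_dist_iff, hre] at hd
  simp only [I_re, I_im, twoI_re, twoI_im] at hd
  rw [div_eq_div_iff (by positivity) (by positivity)] at hd
  -- The circle meets the imaginary axis in `2I` and `I / 2`, which `z ↦ -1 / z` interchanges.
  have hfac : ((R • z).im - 2) * ((R • z).im - 1 / 2) = 0 := by linarith
  rcases mul_eq_zero.1 hfac with him | him
  · exact ⟨R, hRI, UpperHalfPlane.ext (Complex.ext hre (sub_eq_zero.1 him))⟩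
  · let Q : SL(2, ℝ) := ⟨!![0, 1; -1, 0], by simp⟩
    have hQI : Q • I = I := (sl_smul_I_eq_I_iff Q).2 ⟨rfl, (neg_neg _).symm⟩
    refine ⟨Q * R, by rw [mul_smul, hRI, hQI], ?_⟩
    have hz : ((R • z : ℍ) : ℂ) = Complex.I / 2 := by
      apply Complex.ext
      · simpa using hre
      · simpa using sub_eq_zero.1 him
    rw [mul_smul]
    ext1
    rw [coe_specialLinearGroup_apply, hz]
    apply Complex.ext <;> simp [Q, twoI]

theorem J_smul_re (z : ℍ) : (J • z).re = -z.re := by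
  rw [← coe_re, coe_J_smul]
  simp

theorem J_smul_im (z : ℍ) : (J • z).im = z.im := by
  rw [← coe_im, coe_J_smul]
  simp

theorem dist_J_smul_J_smul (z w : ℍ) : dist (J • z) (J • w) = dist z w := by
  rw [dist_eq_dist_iff]
  simp only [J_smul_re, J_smul_im]
  ring

/-- Every isometry of the hyperbolic plane is a Möbius transformation, or a Möbius transformation
after the reflection `z ↦ -conj z`. -/
theorem exists_sl_smul_eq (g : ℍ ≃ᵢ ℍ) :
    (∃ A : SL(2, ℝ), ∀ z, g z = A • z) ∨ ∃ A : SL(2, ℝ), ∀ z, g z = A • J • z := by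
  obtain ⟨M, hM⟩ := MulAction.exists_smul_eq SL(2, ℝ) (g I) I
  obtain ⟨K, hKI, hK⟩ := exists_smul_eq_twoI (z := M • g twoI) <| by
    conv_lhs => rw [← hM]
    rw [dist_smul, g.dist_eq]
  let f : ℍ → ℍ := fun z => (K * M) • g z
  have hf : ∀ z w, dist (f z) (f w) = dist z w := fun z w => by
    simp only [f]
    rw [dist_smul, g.dist_eq]
  have hfI : f I = I := by simp only [f]; rw [mul_smul, hM, hKI]
  have hf2 : f twoI = twoI := by simp only [f]; rw [mul_smul, hK]
  have hg : ∀ z, g z = (K * M)⁻¹ • f z := fun z => (inv_smul_smul _ _).symm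
  have hdI : ∀ z, dist (f z) I = dist z I := fun z => by conv_lhs => rw [← hfI, hf]
  have hd2 : ∀ z, dist (f z) twoI = dist z twoI := fun z => by conv_lhs => rw [← hf2, hf]
  -- Since `f` fixes `I` and `2I`, it sends `1 + I` to itself or to its mirror image. Thus `f` or `J
  -- • f` fixes three points that determine every other point by distances.
  obtain ⟨him, hre⟩ := im_eq_and_re_sq_eq_of_dist_eq (hdI onePlusI) (hd2 onePlusI)
  rcases sq_eq_sq_iff_eq_or_eq_neg.1 hre with h | h
  · have hf3 : f onePlusI = onePlusI := UpperHalfPlane.ext (Complex.ext h him)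
    refine Or.inl ⟨(K * M)⁻¹, fun z => ?_⟩
    rw [hg, eq_of_dist_eq (hdI z) (hd2 z) (by conv_lhs => rw [← hf3, hf])]
  · have hf3 : f onePlusI = J • onePlusI :=
      UpperHalfPlane.ext (Complex.ext (h.trans (J_smul_re _).symm) (him.trans (J_smul_im _).symm))
    have hJI : J • I = I := UpperHalfPlane.ext (Complex.ext (by simp [J_smul_re]) (J_smul_im _))
    have hJ2 : J • twoI = twoI :=
      UpperHalfPlane.ext (Complex.ext (by simp [J_smul_re]) (J_smul_im _))
    have hJJ : ∀ z : ℍ, J • J • z = z := fun z => by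
      rw [← mul_smul, ← pow_two, J_sq, one_smul]
    refine Or.inr ⟨(K * M)⁻¹, fun z => ?_⟩
    have hz : J • f z = z := eq_of_dist_eq
      (by conv_lhs => rw [← hJI, dist_J_smul_J_smul, hdI])
      (by conv_lhs => rw [← hJ2, dist_J_smul_J_smul, hd2])
      (by rw [← hf z onePlusI, hf3, ← dist_J_smul_J_smul (f z), hJJ])
    rw [hg]
    conv_rhs => rw [← hz, hJJ]

/-- Isometries of the hyperbolic plane that are Möbius transformations. -/
def IsMoebius (g : ℍ ≃ᵢ ℍ) : Prop := ∃ A : SL(2, ℝ), ∀ z, g z = A • z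

/-- The two reflections `J` cancel in the quotient. -/
theorem isMoebius_mul_inv {g h : ℍ ≃ᵢ ℍ} (hg : ¬ IsMoebius g) (hh : ¬ IsMoebius h) :
    IsMoebius (g * h⁻¹) := by
  obtain ⟨A, hA⟩ := (exists_sl_smul_eq g).resolve_left hg
  obtain ⟨B, hB⟩ := (exists_sl_smul_eq h).resolve_left hh
  refine ⟨A * B⁻¹, fun z => ?_⟩
  have hz : z = B • J • h⁻¹ z := by rw [← hB, IsometryEquiv.apply_inv_self]
  conv_rhs => rw [hz]
  rw [mul_smul, inv_smul_smul, IsometryEquiv.mul_apply, hA]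

theorem inv_apply_eq_inv_smul {g : ℍ ≃ᵢ ℍ} {A : SL(2, ℝ)} (h : ∀ z, g z = A • z) (z : ℍ) :
    g⁻¹ z = A⁻¹ • z := by
  rw [eq_inv_smul_iff, ← h, IsometryEquiv.apply_inv_self]

/-! ### Infinite subgroups and hyperbolic elements -/

/-- In a cocompact discrete group, a Möbius transformation that is not hyperbolic has a fixed
point. -/
theorem IsCrystallographic.exists_fixed_of_not_isHyperbolic {Γ : Subgroup (ℍ ≃ᵢ ℍ)}
    (hΓ : IsCrystallographic Γ) {g : ℍ ≃ᵢ ℍ} (hg : g ∈ Γ) {A : SL(2, ℝ)}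
    (hA : ∀ z, g z = A • z) (hyp : ¬ (A : Matrix (Fin 2) (Fin 2) ℝ).IsHyperbolic) :
    ∃ z, g z = z := by
  rcases (not_lt.1 hyp).lt_or_eq with h | h
  · obtain ⟨z, hz⟩ := exists_fixed_of_discr_neg h
    exact ⟨z, (hA z).trans hz⟩
  · by_contra! hfix
    obtain ⟨c, hc, hle⟩ := hΓ.exists_le_dist hg hfix
    obtain ⟨z, hz⟩ := exists_dist_smul_lt_of_discr_eq_zero h hc
    exact (hle z).not_gt (by rwa [hA])

/-- An infinite subgroup of a cocompact discrete group of isometries of the hyperbolic plane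
contains a translation. -/
theorem exists_isHyperbolicTranslation {Γ H : Subgroup (ℍ ≃ᵢ ℍ)} (hΓ : IsCrystallographic Γ)
    (hH : H ≤ Γ) (hinf : Infinite H) : ∃ g ∈ H, IsHyperbolicTranslation g := by
  by_contra! hno
  refine not_finite_iff_infinite.2 hinf (finite_of_finite_index_two H IsMoebius
    (fun g _ h _ => isMoebius_mul_inv) ?_)
  by_cases htriv : ∀ g ∈ H, IsMoebius g → g = 1
  · exact (Set.finite_singleton 1).subset fun g hg => htriv g hg.1 hg.2
  push Not at htriv
  obtain ⟨g, hg, ⟨A, hA⟩, hg1⟩ := htriv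
  obtain ⟨p, hp⟩ := hΓ.exists_fixed_of_not_isHyperbolic (hH hg) hA fun h => hno g hg ⟨A, h, hA⟩
  obtain ⟨w, hw⟩ : ∃ w, g w ≠ w := by
    by_contra! hall
    exact hg1 (IsometryEquiv.ext hall)
  refine (hΓ.discrete.finite_dist_le p 0).subset ?_
  rintro h ⟨hh, B, hB⟩
  refine ⟨hH hh, ?_⟩
  have hfix : h p = p := by
    by_contra hne
    refine hno (g * h * g⁻¹ * h⁻¹)
      (H.mul_mem (H.mul_mem (H.mul_mem hg hh) (H.inv_mem hg)) (H.inv_mem hh))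
      ⟨A * B * A⁻¹ * B⁻¹, isHyperbolic_commutator (p := p) (w := w) ?_ ?_ ?_, fun z => ?_⟩
    · rwa [← hA]
    · rwa [← hA]
    · rwa [← hB]
    · simp only [IsometryEquiv.mul_apply, mul_smul, inv_apply_eq_inv_smul hA,
        inv_apply_eq_inv_smul hB, hA, hB]
  rw [hfix, dist_self]

theorem sl_eq_scalar_of_forall_smul_eq {A : SL(2, ℝ)} (h : ∀ z : ℍ, A • z = z) :
    A 0 0 = A 1 1 ∧ A 0 1 = 0 ∧ A 1 0 = 0 := by
  obtain ⟨h1, h2⟩ := (sl_smul_I_eq_I_iff A).1 (h I)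
  have h3 := congrArg Complex.re ((sl_smul_eq_self_iff A twoI).1 (h twoI))
  simp [twoI, h1] at h3
  exact ⟨h1, by linarith, by linarith⟩

/-- No positive power of a hyperbolic matrix acts trivially on `ℍ`. -/
theorem exists_pow_smul_ne {A : SL(2, ℝ)} (hA : (A : Matrix (Fin 2) (Fin 2) ℝ).IsHyperbolic)
    {n : ℕ} (hn : n ≠ 0) : ∃ z : ℍ, A ^ n • z ≠ z := by
  by_contra! hall
  obtain ⟨h1, h2, h3⟩ := sl_eq_scalar_of_forall_smul_eq hall
  have hdet := sl_det_eq (A ^ n)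
  rw [Matrix.IsHyperbolic, sl_discr] at hA
  set t := A 0 0 + A 1 1 with ht
  -- Since `t ^ 2 > 4`, there is a real eigenvalue `l`. If `A ^ n` is scalar of determinant 1, then
  -- `l ^ (2 n) = 1`, hence `l ^ 2 = 1`, and the characteristic equation yields `t ^ 2 = 4`.
  obtain ⟨l, hl⟩ : ∃ l : ℝ, l ^ 2 - t * l + 1 = 0 :=
    ⟨(t + √(t ^ 2 - 4)) / 2, by linear_combination Real.sq_sqrt hA.le / 4⟩
  obtain ⟨v, hv, hAv⟩ : ∃ v ≠ 0,
      ((A : Matrix (Fin 2) (Fin 2) ℝ) - Matrix.scalar (Fin 2) l).mulVec v = 0 := by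
    rw [Matrix.exists_mulVec_eq_zero_iff, Matrix.det_fin_two]
    simp
    linear_combination hl + sl_det_eq A + l * ht
  rw [Matrix.sub_mulVec, sub_eq_zero] at hAv
  have hscal : ∀ (a : ℝ), (Matrix.scalar (Fin 2) a).mulVec v = a • v := fun a => by
    ext i
    simp [Matrix.mulVec_diagonal]
  rw [hscal] at hAv
  have hpow : ∀ k : ℕ, ((A : Matrix (Fin 2) (Fin 2) ℝ) ^ k).mulVec v = l ^ k • v := fun k => by
    induction k with
    | zero => simp
    | succ k ih =>
      rw [pow_succ', ← Matrix.mulVec_mulVec, ih, Matrix.mulVec_smul, hAv, smul_smul, pow_succ]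
  have hAn : (A : Matrix (Fin 2) (Fin 2) ℝ) ^ n = Matrix.scalar (Fin 2) ((A ^ n) 1 1) := by
    rw [← Matrix.SpecialLinearGroup.coe_pow]
    ext i j
    fin_cases i <;> fin_cases j <;> simp [h1, h2, h3]
  have hln : l ^ n = (A ^ n) 1 1 := by
    have := hpow n
    rw [hAn, hscal] at this
    exact (smul_left_injective ℝ hv this).symm
  have hl2 : l ^ 2 = 1 := by
    rw [h1, h3, ← hln] at hdet
    rw [← pow_eq_one_iff_of_nonneg (sq_nonneg l) hn, ← pow_mul, mul_comm, pow_mul]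
    linarith
  have h4 : t * l = 2 := by linarith
  have h5 : t ^ 2 * l ^ 2 = 4 := by rw [← mul_pow, h4]; norm_num
  rw [hl2] at h5
  linarith

theorem IsHyperbolicTranslation.infinite {H : Subgroup (ℍ ≃ᵢ ℍ)} {g : ℍ ≃ᵢ ℍ} (hg : g ∈ H)
    (ht : IsHyperbolicTranslation g) : Infinite H := by
  obtain ⟨A, hA, hgA⟩ := ht
  have hpow : ∀ (n : ℕ) (z : ℍ), (g ^ n) z = A ^ n • z := fun n => by
    induction n with
    | zero => simp
    | succ n ih =>
      intro z
      rw [pow_succ', IsometryEquiv.mul_apply, ih, hgA, pow_succ', mul_smul]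
  have hfin : ¬ IsOfFinOrder g := fun h => by
    obtain ⟨n, hn, hgn⟩ := isOfFinOrder_iff_pow_eq_one.1 h
    obtain ⟨z, hz⟩ := exists_pow_smul_ne hA hn.ne'
    rw [← hpow, hgn] at hz
    exact hz rfl
  exact Infinite.of_injective (fun n : ℕ => (⟨g ^ n, H.pow_mem hg n⟩ : H)) fun m n hmn =>
    injective_pow_iff_not_isOfFinOrder.2 hfin (congrArg Subtype.val hmn)

end Hyperbolic

theorem tileStabilizer_le {X : Type*} [MetricSpace X] (Γ : Subgroup (X ≃ᵢ X)) (T : Set X) :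
    tileStabilizer Γ T ≤ Γ := fun _ h => h.1

end RibbonTiling

open RibbonTiling in
theorem mainTheorem2 :
    (∀ (Γ : Subgroup (EuclideanPlane ≃ᵢ EuclideanPlane)) (𝓕 : Set (Set EuclideanPlane))
        (S : Set (Set (OrbitSpace Γ))) (T : Set EuclideanPlane),
      IsCrystallographic Γ → IsFundamentalTransitiveTiling Γ 𝓕 →
      S ⊆ orbifoldEdges Γ 𝓕 → T ∈ edgeDeletion Γ 𝓕 S →
      (Infinite (tileStabilizer Γ T) ↔ ∃ g ∈ tileStabilizer Γ T, IsEuclideanTranslation g)) ∧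
    (∀ (Γ : Subgroup (UpperHalfPlane ≃ᵢ UpperHalfPlane)) (𝓕 : Set (Set UpperHalfPlane))
        (S : Set (Set (OrbitSpace Γ))) (T : Set UpperHalfPlane),
      IsCrystallographic Γ → IsFundamentalTransitiveTiling Γ 𝓕 →
      S ⊆ orbifoldEdges Γ 𝓕 → T ∈ edgeDeletion Γ 𝓕 S →
      (Infinite (tileStabilizer Γ T) ↔ ∃ g ∈ tileStabilizer Γ T, IsHyperbolicTranslation g)) :=
  ⟨fun _ _ _ _ hΓ _ _ _ =>
    ⟨exists_isEuclideanTranslation hΓ.discrete (tileStabilizer_le _ _),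
      fun ⟨_, hg, ht⟩ => ht.infinite hg⟩,
  fun _ _ _ _ hΓ _ _ _ =>
    ⟨exists_isHyperbolicTranslation hΓ (tileStabilizer_le _ _),
      fun ⟨_, hg, ht⟩ => ht.infinite hg⟩⟩
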